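/- Let $\mathbb K\in\{\mathbb R,\mathbb C\}$, let $X$ be a metric space with base point $0$, and let $E,F$ be Banach spaces over $\mathbb K$. Let $X^{\#}=\mathrm{Lip}_0(X;\mathbb K)$ be the space of Lipschitz functions $f:X\to\mathbb K$ with $f(0)=0$, normed by the Lipschitz constant, with closed unit ball $B_{X^\#}$; put $\delta_x(f)=f(x)$ and let $\mathcal F(X)=\overline{\mathrm{span}}\{\delta_x:x\in X\}\subset (X^{\#})^*$ be the Lipschitz-free space. Let $LipL_0(X\times E;F)$ be the space of Lip-Linear operators $T:X\times E\to F$ with $T(0,\cdot)=0$, that is, $T(x,\cdot)$ is linear for every $x$ and, for some $C>0$, $\|T(x,e)-T(y,e)\|\le C\,d(x,y)\|e\|$ for all $x,y\in X$, $e\in E$. For such $T$ let $T_{bil}:\mathcal F(X)\times E\to F$ be the unique continuous bilinear operator with $T_{bil}(\delta_x,e)=T(x,e)$. $T\in LipL_0(X\times E;F)$ is called integral if there is $C>0$ such that for all $n$, $x_i,y_i\in X$, $e_i\in E$, $z_i^*\in F^*$ ($1\le i\le n$), $$\Big|\sum_{i=1}^n\langle T(x_i,e_i)-T(y_i,e_i),z_i^*\rangle\Big|\le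 C\sup_{f\in B_{X^{\#}},\,\|e^*\|=1}\Big\|\sum_{i=1}^n (f(x_i)-f(y_i))\,e^*(e_i)\,z_i^*\Big\|_{F^*};$$ $\mathfrak I^{LipL}_{int}(T)$ is the infimum of these $C$, and $LipL_0^{int}(X\times E;F)$ is the space of integral operators with this norm. A continuous bilinear operator $B:G\times E\to F$ ($G$ a Banach space) is called integral if there is $C>0$ such that for all $n$, $x_i\in G$, $e_i\in E$, $z_i^*\in F^*$, $$\Big|\sum_{i=1}^n\langle B(x_i,e_i),z_i^*\rangle\Big|\le C\sup_{x^*\in B_{G^*},\,e^*\in B_{E^*}}\Big\|\sum_{i=1}^n x^*(x_i)\,e^*(e_i)\,z_i^*\Big\|_{F^*};$$ $\mathfrak I^{2}_{int}(B)$ is the infimum of these $C$, and $\mathcal{BI}(G\times E;F)$ is the space of integral bilinear operators with this norm. Let $X\boxtimes E$ be the span of the functionals $\delta_{(x,y)}\boxtimes e: g\mapsto\langle g(x)-g(y),e\rangle$ on $\mathrm{Lip}_0(X;E^*)$, and let $X\widehat\boxtimes_\varepsilon E$ be its completion for the norm $\varepsilon\big(\sum_i\delta_{(x_i,y_i)}\boxtimes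 e_i\big)=\sup_{f\in B_{X^\#},\,\|e^*\|=1}\big|\sum_i(f(x_i)-f(y_i))e^*(e_i)\big|$. Then: 1. A Lip-Linear operator $T\in LipL_0(X\times E;F)$ is integral if and only if $T_{bil}$ is an integral bilinear operator, and in this case $\mathfrak I^{LipL}_{int}(T)=\mathfrak I^2_{int}(T_{bil})$. 2. The map $T\mapsto T_{bil}$ is a linear isometric bijection of $LipL_0^{int}(X\times E;F)$ onto $\mathcal{BI}(\mathcal F(X)\times E;F)$. 3. In particular, $(X\widehat\boxtimes_\varepsilon E)^*=LipL_0^{int}(X\times E;\mathbb K)$: the map sending a functional $\varphi$ to $(x,e)\mapsto\varphi(\delta_{(x,0)}\boxtimes e)$ is a linear isometric bijection of $(X\widehat\boxtimes_\varepsilon E)^*$ onto $LipL_0^{int}(X\times E;\mathbb K)$. -/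

import Mathlib

noncomputable section

namespace LipLin

/-! ## Norms given as the least admissible constant -/

/-- The infimum of the admissible constants `C > 0` is a norm as soon as the relation
"`C` is admissible for `v`" satisfies the obvious homogeneity and subadditivity rules. -/
theorem core_sInf {𝕜 V : Type*} [RCLike 𝕜] [AddCommGroup V] [Module 𝕜 V] [Norm V]
    (P : V → ℝ → Prop) (hnorm : ∀ v, ‖v‖ = sInf {C : ℝ | 0 < C ∧ P v C})
    (hex : ∀ v, ∃ C, 0 < C ∧ P v C)
    (hadd : ∀ v w C D, P v C → P w D → P (v + w) (C + D))
    (hsmul : ∀ (c : 𝕜) v C, P v C → P (c • v) (‖c‖ * C))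
    (hmono : ∀ v C D, C ≤ D → P v C → P v D)
    (hzero : ∀ v, (∀ C, 0 < C → P v C) → v = 0) : NormedSpace.Core 𝕜 V := by
  have hbdd : ∀ v, BddBelow {C : ℝ | 0 < C ∧ P v C} := fun v => ⟨0, fun C hC => hC.1.le⟩
  have hne : ∀ v, {C : ℝ | 0 < C ∧ P v C}.Nonempty := hex
  have hnn : ∀ v : V, 0 ≤ ‖v‖ := fun v => by
    rw [hnorm]; exact Real.sInf_nonneg fun C hC => hC.1.le
  have happ : ∀ v C, ‖v‖ < C → P v C := fun v C h => by
    rw [hnorm] at h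
    obtain ⟨D, hD, hDC⟩ := exists_lt_of_csInf_lt (hne v) h
    exact hmono v D C hDC.le hD.2
  have hle : ∀ v C, 0 < C → P v C → ‖v‖ ≤ C := fun v C h0 h => by
    rw [hnorm]; exact csInf_le (hbdd v) ⟨h0, h⟩
  have hle' : ∀ v C, 0 ≤ C → P v C → ‖v‖ ≤ C := fun v C h0 h =>
    le_of_forall_pos_le_add fun ε hε =>
      hle v (C + ε) (by linarith) (hmono v C _ (by linarith) h)
  have hz0 : ‖(0 : V)‖ = 0 := by
    obtain ⟨C, _, hC⟩ := hex 0
    have h := hsmul 0 0 C hC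
    rw [norm_zero, zero_mul, smul_zero] at h
    exact le_antisymm (hle' 0 0 le_rfl h) (hnn 0)
  have hsm : ∀ (c : 𝕜) (v : V), ‖c • v‖ ≤ ‖c‖ * ‖v‖ := fun c v => by
    refine le_of_forall_pos_le_add fun ε hε => ?_
    have hpos : 0 < ‖c‖ + 1 := by positivity
    have hd : 0 < ε / (‖c‖ + 1) := by positivity
    have h := hsmul c v (‖v‖ + ε / (‖c‖ + 1)) (happ v _ (by linarith))
    refine (hle' _ _ (by have := hnn v; positivity) h).trans ?_
    rw [mul_add]
    have : ‖c‖ * (ε / (‖c‖ + 1)) ≤ ε := by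
      rw [mul_div_assoc', div_le_iff₀ hpos]
      nlinarith [norm_nonneg c]
    linarith
  refine { norm_nonneg := hnn, norm_smul := fun c v => ?_, norm_triangle := fun v w => ?_,
           norm_eq_zero_iff := fun v => ⟨fun h => ?_, fun h => by rw [h, hz0]⟩ }
  · refine le_antisymm (hsm c v) ?_
    by_cases hc : c = 0
    · simp [hc, hnn]
    · have h := hsm c⁻¹ (c • v)
      rw [smul_smul, inv_mul_cancel₀ hc, one_smul, norm_inv] at h
      have hc' : 0 < ‖c‖ := norm_pos_iff.mpr hc
      calc ‖c‖ * ‖v‖ ≤ ‖c‖ * (‖c‖⁻¹ * ‖c • v‖) := by gcongr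
        _ = ‖c • v‖ := by field_simp
  · refine le_of_forall_pos_le_add fun ε hε => ?_
    have h := hadd v w (‖v‖ + ε / 2) (‖w‖ + ε / 2) (happ v _ (by linarith))
      (happ w _ (by linarith))
    refine (hle' _ _ (by have := hnn v; have := hnn w; positivity) h).trans (by linarith)
  · exact hzero v fun C hC => happ v C (by rw [h]; exact hC)

/-! ## Lipschitz maps vanishing at the base point

A pointed metric space is a metric space `X` with a distinguished point `0`
(`[MetricSpace X] [Zero X]`). -/

section Lip

variable (𝕜 X G : Type*) [RCLike 𝕜] [MetricSpace X] [Zero X]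
  [NormedAddCommGroup G] [NormedSpace 𝕜 G]

/-- Lipschitz maps `X → G` vanishing at `0`, as a linear subspace of all maps. -/
def lipZeroSubmodule : Submodule 𝕜 (X → G) where
  carrier := {f | f 0 = 0 ∧ ∃ K : ℝ, ∀ x y, ‖f x - f y‖ ≤ K * dist x y}
  zero_mem' := ⟨rfl, 0, by simp⟩
  add_mem' := by
    rintro f g ⟨hf, K, hK⟩ ⟨hg, L, hL⟩
    refine ⟨by simp [hf, hg], K + L, fun x y => ?_⟩
    calc ‖(f + g) x - (f + g) y‖ = ‖(f x - f y) + (g x - g y)‖ := by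
          simp only [Pi.add_apply]; congr 1; abel
      _ ≤ ‖f x - f y‖ + ‖g x - g y‖ := norm_add_le _ _
      _ ≤ (K + L) * dist x y := by rw [add_mul]; exact add_le_add (hK x y) (hL x y)
  smul_mem' := by
    rintro c f ⟨hf, K, hK⟩
    refine ⟨by simp [hf], ‖c‖ * K, fun x y => ?_⟩
    rw [Pi.smul_apply, Pi.smul_apply, ← smul_sub, norm_smul, mul_assoc]
    exact mul_le_mul_of_nonneg_left (hK x y) (norm_nonneg c)

/-- The space `Lip₀(X; G)`; it carries the Lipschitz norm below. -/
def LipZero : Type _ := lipZeroSubmodule 𝕜 X G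

instance : AddCommGroup (LipZero 𝕜 X G) := inferInstanceAs (AddCommGroup (lipZeroSubmodule 𝕜 X G))
instance : Module 𝕜 (LipZero 𝕜 X G) := inferInstanceAs (Module 𝕜 (lipZeroSubmodule 𝕜 X G))
instance : FunLike (LipZero 𝕜 X G) X G := ⟨fun f => f.1, Subtype.val_injective⟩

variable {𝕜 X G}

@[ext] theorem LipZero.ext {f g : LipZero 𝕜 X G} (h : ∀ x, f x = g x) : f = g :=
  DFunLike.ext f g h

/-- A Lipschitz map vanishing at `0`, as an element of `Lip₀(X; G)`. -/
def LipZero.mk (f : X → G) (h0 : f 0 = 0) (K : ℝ) (h : ∀ x y, ‖f x - f y‖ ≤ K * dist x y) :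
    LipZero 𝕜 X G := ⟨f, h0, K, h⟩

@[simp] theorem LipZero.mk_apply (f : X → G) (h0 : f 0 = 0) (K : ℝ)
    (h : ∀ x y, ‖f x - f y‖ ≤ K * dist x y) (x : X) :
    (LipZero.mk f h0 K h : LipZero 𝕜 X G) x = f x := rfl

@[simp] theorem LipZero.add_apply (f g : LipZero 𝕜 X G) (x : X) : (f + g) x = f x + g x := rfl
@[simp] theorem LipZero.smul_apply (c : 𝕜) (f : LipZero 𝕜 X G) (x : X) : (c • f) x = c • f x := rfl
@[simp] theorem LipZero.zero_apply (x : X) : (0 : LipZero 𝕜 X G) x = 0 := rfl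
@[simp] theorem LipZero.map_zero (f : LipZero 𝕜 X G) : f 0 = 0 := f.2.1

/-- `Lip(f) = sup_{x ≠ y} ‖f x - f y‖ / d(x, y)`; the pairs with `x = y` contribute `0 / 0 = 0`. -/
instance : Norm (LipZero 𝕜 X G) := ⟨fun f => ⨆ p : X × X, ‖f p.1 - f p.2‖ / dist p.1 p.2⟩

theorem LipZero.norm_def (f : LipZero 𝕜 X G) :
    ‖f‖ = ⨆ p : X × X, ‖f p.1 - f p.2‖ / dist p.1 p.2 := rfl

theorem LipZero.bdd (f : LipZero 𝕜 X G) :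
    BddAbove (Set.range fun p : X × X => ‖f p.1 - f p.2‖ / dist p.1 p.2) := by
  obtain ⟨_, K, hK⟩ := f.2
  refine ⟨max K 0, ?_⟩
  rintro _ ⟨⟨x, y⟩, rfl⟩
  refine div_le_of_le_mul₀ dist_nonneg (le_max_right _ _) ((hK x y).trans ?_)
  exact mul_le_mul_of_nonneg_right (le_max_left _ _) dist_nonneg

theorem LipZero.norm_sub_le (f : LipZero 𝕜 X G) (x y : X) :
    ‖f x - f y‖ ≤ ‖f‖ * dist x y := by
  by_cases h : x = y
  · subst h; simp
  · have hd : 0 < dist x y := dist_pos.mpr h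
    exact (div_le_iff₀ hd).mp (le_ciSup f.bdd (x, y))

theorem LipZero.nonneg (f : LipZero 𝕜 X G) : 0 ≤ ‖f‖ :=
  Real.iSup_nonneg fun _ => div_nonneg (norm_nonneg _) dist_nonneg

theorem LipZero.norm_le (f : LipZero 𝕜 X G) {C : ℝ} (hC : 0 ≤ C)
    (h : ∀ x y, ‖f x - f y‖ ≤ C * dist x y) : ‖f‖ ≤ C :=
  ciSup_le fun p => div_le_of_le_mul₀ dist_nonneg hC (h p.1 p.2)

theorem LipZero.core : NormedSpace.Core 𝕜 (LipZero 𝕜 X G) where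
  norm_nonneg := LipZero.nonneg
  norm_smul c f := by
    rw [LipZero.norm_def, LipZero.norm_def, Real.mul_iSup_of_nonneg (norm_nonneg c)]
    congr 1; ext p
    rw [LipZero.smul_apply, LipZero.smul_apply, ← smul_sub, norm_smul, mul_div_assoc]
  norm_triangle f g := by
    refine LipZero.norm_le _ (add_nonneg f.nonneg g.nonneg) fun x y => ?_
    calc ‖(f + g) x - (f + g) y‖ = ‖(f x - f y) + (g x - g y)‖ := by
          simp only [LipZero.add_apply]; congr 1; abel
      _ ≤ ‖f x - f y‖ + ‖g x - g y‖ := norm_add_le _ _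
      _ ≤ _ := by rw [add_mul]; exact add_le_add (f.norm_sub_le x y) (g.norm_sub_le x y)
  norm_eq_zero_iff f := by
    refine ⟨fun h => LipZero.ext fun x => ?_, fun h => ?_⟩
    · have := f.norm_sub_le x 0
      rw [h, zero_mul, LipZero.map_zero, sub_zero] at this
      exact norm_le_zero_iff.mp this
    · subst h
      exact le_antisymm (LipZero.norm_le _ le_rfl (by simp)) (LipZero.nonneg _)

instance : NormedAddCommGroup (LipZero 𝕜 X G) := NormedAddCommGroup.ofCore LipZero.core
instance : NormedSpace 𝕜 (LipZero 𝕜 X G) := NormedSpace.ofCore LipZero.core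

end Lip

/-! ## The Lipschitz-free space -/

section Free

variable (𝕜 X : Type*) [RCLike 𝕜] [MetricSpace X] [Zero X]

variable {X} in
/-- The evaluation functional `δ_x` on `X^# = Lip₀(X; 𝕜)`. -/
def evalDual (x : X) : StrongDual 𝕜 (LipZero 𝕜 X 𝕜) :=
  LinearMap.mkContinuous
    { toFun := fun f => f x, map_add' := fun _ _ => rfl, map_smul' := fun _ _ => rfl }
    (dist x 0) (fun f => by
      have := f.norm_sub_le x 0
      rw [LipZero.map_zero, sub_zero] at this
      rw [mul_comm]; exact this)

/-- The closed linear span of the `δ_x` in `(X^#)*`. -/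
def freeSpace : Submodule 𝕜 (StrongDual 𝕜 (LipZero 𝕜 X 𝕜)) :=
  (Submodule.span 𝕜 (Set.range (evalDual 𝕜 (X := X)))).topologicalClosure

/-- The Lipschitz-free space `𝓕(X)`, with the norm of `(X^#)*`. -/
def LipFree : Type _ := freeSpace 𝕜 X

instance : NormedAddCommGroup (LipFree 𝕜 X) := inferInstanceAs (NormedAddCommGroup (freeSpace 𝕜 X))
instance : NormedSpace 𝕜 (LipFree 𝕜 X) := inferInstanceAs (NormedSpace 𝕜 (freeSpace 𝕜 X))

/-- The inclusion `𝓕(X) → (X^#)*`. -/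
def LipFree.incl : LipFree 𝕜 X →L[𝕜] StrongDual 𝕜 (LipZero 𝕜 X 𝕜) := (freeSpace 𝕜 X).subtypeL

variable {X} in
/-- The canonical map `δ_X : X → 𝓕(X)`. -/
def delta (x : X) : LipFree 𝕜 X :=
  ⟨evalDual 𝕜 x, Submodule.le_topologicalClosure _ (Submodule.subset_span ⟨x, rfl⟩)⟩

variable {𝕜 X} {G : Type*} [NormedAddCommGroup G] [NormedSpace 𝕜 G]

/-- Two continuous linear maps on `𝓕(X)` that agree on all `δ_x` are equal. -/
theorem freeSpace_ext {A B : LipFree 𝕜 X →L[𝕜] G} (h : ∀ x, A (delta 𝕜 x) = B (delta 𝕜 x)) :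
    A = B := by
  ext ⟨m, hm⟩
  have key : ∀ m ∈ Submodule.span 𝕜 (Set.range (evalDual 𝕜 (X := X))),
      ∀ hm : m ∈ freeSpace 𝕜 X, A ⟨m, hm⟩ = B ⟨m, hm⟩ := by
    intro m hm
    induction hm using Submodule.span_induction with
    | mem m h' => obtain ⟨x, rfl⟩ := h'; exact fun _ => h x
    | zero => intro _; exact (map_zero A).trans (map_zero B).symm
    | add a b ha hb iha ihb =>
      intro _
      have h1 := iha (Submodule.le_topologicalClosure _ ha)
      have h2 := ihb (Submodule.le_topologicalClosure _ hb)
      exact (map_add A ⟨a, _⟩ ⟨b, _⟩).trans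
        ((congrArg₂ (· + ·) h1 h2).trans (map_add B ⟨a, _⟩ ⟨b, _⟩).symm)
    | smul c a ha iha =>
      intro _
      have h1 := iha (Submodule.le_topologicalClosure _ ha)
      exact (map_smul A c ⟨a, _⟩).trans
        ((congrArg (c • ·) h1).trans (map_smul B c ⟨a, _⟩).symm)
  have hcl : IsClosed {m : LipFree 𝕜 X | A m = B m} := isClosed_eq A.continuous B.continuous
  have hm' := hm
  rw [freeSpace, ← SetLike.mem_coe, Submodule.topologicalClosure_coe, Metric.mem_closure_iff] at hm'
  refine hcl.closure_subset (Metric.mem_closure_iff.mpr fun ε hε => ?_)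
  obtain ⟨b, hb, hd⟩ := hm' ε hε
  exact ⟨⟨b, Submodule.le_topologicalClosure _ hb⟩, key b hb _, hd⟩

/-- Composition with `R ∈ Lip₀(X; G)`, as the operator `G* → X^#`, `z ↦ z ∘ R`. -/
def compDual (R : LipZero 𝕜 X G) : StrongDual 𝕜 G →L[𝕜] LipZero 𝕜 X 𝕜 :=
  LinearMap.mkContinuous
    { toFun := fun z => LipZero.mk (fun x => z (R x)) (by simp) (‖z‖ * ‖R‖) (fun x y => by
        rw [← map_sub, mul_assoc]
        exact (z.le_opNorm _).trans
          (mul_le_mul_of_nonneg_left (R.norm_sub_le x y) (norm_nonneg z)))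
      map_add' := fun _ _ => rfl
      map_smul' := fun _ _ => rfl }
    ‖R‖ (fun z => LipZero.norm_le _ (by positivity) fun x y => by
      change ‖z (R x) - z (R y)‖ ≤ _
      rw [← map_sub, mul_comm ‖R‖, mul_assoc]
      exact (z.le_opNorm _).trans
        (mul_le_mul_of_nonneg_left (R.norm_sub_le x y) (norm_nonneg z)))

/-- The linearization of `R` with values in the bidual: `m ↦ (z ↦ m (z ∘ R))`. -/
def bidualLin (R : LipZero 𝕜 X G) : LipFree 𝕜 X →L[𝕜] StrongDual 𝕜 (StrongDual 𝕜 G) :=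
  ((ContinuousLinearMap.compL 𝕜 (StrongDual 𝕜 G) (LipZero 𝕜 X 𝕜) 𝕜).flip (compDual R)).comp
    (LipFree.incl 𝕜 X)

theorem bidualLin_delta (R : LipZero 𝕜 X G) (x : X) :
    bidualLin R (delta 𝕜 x) = NormedSpace.inclusionInDoubleDualLi 𝕜 (R x) := rfl

theorem bidualLin_mem [CompleteSpace G] (R : LipZero 𝕜 X G) (m : LipFree 𝕜 X) :
    ∃ g : G, NormedSpace.inclusionInDoubleDualLi 𝕜 g = bidualLin R m := by
  let S := LinearMap.range (NormedSpace.inclusionInDoubleDualLi 𝕜 (E := G)).toLinearMap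
  have hS : IsClosed (S : Set (StrongDual 𝕜 (StrongDual 𝕜 G))) := by
    have := (NormedSpace.inclusionInDoubleDualLi 𝕜 (E := G)).isometry
    have h2 := this.isUniformInducing.isComplete_range.isClosed
    simpa [S, LinearMap.coe_range] using h2
  let Φ := (ContinuousLinearMap.compL 𝕜 (StrongDual 𝕜 G) (LipZero 𝕜 X 𝕜) 𝕜).flip (compDual R)
  have hle : freeSpace 𝕜 X ≤ S.comap Φ.toLinearMap := by
    refine Submodule.topologicalClosure_minimal _ ?_ (hS.preimage Φ.continuous)
    rw [Submodule.span_le]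
    rintro _ ⟨x, rfl⟩
    exact ⟨R x, rfl⟩
  exact hle m.2

/-- The linearization `R_L : 𝓕(X) → G` of `R ∈ Lip₀(X; G)`, for `G` complete: `R_L(m)` is the
element of `G` whose image in `G**` is `z ↦ m (z ∘ R)`. -/
def linearize [CompleteSpace G] (R : LipZero 𝕜 X G) : LipFree 𝕜 X →L[𝕜] G :=
  LinearMap.mkContinuous
    { toFun := fun m => (bidualLin_mem R m).choose
      map_add' := fun m m' => (NormedSpace.inclusionInDoubleDualLi 𝕜 (E := G)).injective <|
        (bidualLin_mem R (m + m')).choose_spec.trans <| (map_add (bidualLin R) m m').trans <|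
        (congrArg₂ (· + ·) (bidualLin_mem R m).choose_spec
          (bidualLin_mem R m').choose_spec).symm.trans (map_add _ _ _).symm
      map_smul' := fun c m => (NormedSpace.inclusionInDoubleDualLi 𝕜 (E := G)).injective <|
        (bidualLin_mem R (c • m)).choose_spec.trans <| (map_smul (bidualLin R) c m).trans <|
        (congrArg (c • ·) (bidualLin_mem R m).choose_spec).symm.trans (map_smul _ _ _).symm }
    ‖R‖ (fun m => NormedSpace.norm_le_dual_bound 𝕜 _ (by positivity) fun z => by
      have h : z (bidualLin_mem R m).choose = m.1 (compDual R z) :=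
        DFunLike.congr_fun (bidualLin_mem R m).choose_spec z
      have h2 : ‖compDual R z‖ ≤ ‖R‖ * ‖z‖ :=
        (compDual R).le_of_opNorm_le (LinearMap.mkContinuous_norm_le _ (norm_nonneg R) _) z
      change ‖z (bidualLin_mem R m).choose‖ ≤ _
      rw [h]
      refine (m.1.le_opNorm _).trans ?_
      calc ‖m.1‖ * ‖compDual R z‖ ≤ ‖m.1‖ * (‖R‖ * ‖z‖) := by gcongr
        _ = ‖R‖ * ‖m.1‖ * ‖z‖ := by ring)

theorem linearize_delta [CompleteSpace G] (R : LipZero 𝕜 X G) (x : X) :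
    linearize R (delta 𝕜 x) = R x :=
  (NormedSpace.inclusionInDoubleDualLi 𝕜 (E := G)).injective
    ((bidualLin_mem R (delta 𝕜 x)).choose_spec.trans (bidualLin_delta R x))

end Free

/-! ## Lip-Linear operators -/

section LipLinear

variable (𝕜 X E F : Type*) [RCLike 𝕜] [MetricSpace X] [Zero X]
  [NormedAddCommGroup E] [NormedSpace 𝕜 E] [NormedAddCommGroup F] [NormedSpace 𝕜 F]

variable {X E F} in
/-- Lip-Linear operators `T : X × E → F`. -/
def IsLipLinear (T : X × E → F) : Prop :=
  (∃ C : ℝ, 0 < C ∧ ∀ (x y : X) (e : E), ‖T (x, e) - T (y, e)‖ ≤ C * dist x y * ‖e‖) ∧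
    ∀ x : X, IsLinearMap 𝕜 fun e : E => T (x, e)

/-- `LipL₀(X × E; F)`: the Lip-Linear operators with `T (0, e) = 0` for all `e`. -/
def LipLZero : Submodule 𝕜 (X × E → F) where
  carrier := {T | IsLipLinear 𝕜 T ∧ ∀ e : E, T (0, e) = 0}
  zero_mem' := ⟨⟨⟨1, one_pos, fun x y e => by simp; positivity⟩, fun _ => ⟨by simp, by simp⟩⟩,
    fun _ => rfl⟩
  add_mem' := by
    rintro S T ⟨⟨⟨C, hC, hS⟩, lS⟩, zS⟩ ⟨⟨⟨D, hD, hT⟩, lT⟩, zT⟩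
    refine ⟨⟨⟨C + D, by positivity, fun x y e => ?_⟩, fun x => ?_⟩, fun e => by simp [zS, zT]⟩
    · calc ‖(S + T) (x, e) - (S + T) (y, e)‖
          = ‖(S (x, e) - S (y, e)) + (T (x, e) - T (y, e))‖ := by
            simp only [Pi.add_apply]; congr 1; abel
        _ ≤ _ := norm_add_le _ _
        _ ≤ _ := add_le_add (hS x y e) (hT x y e)
        _ = _ := by ring
    · exact ((lS x).mk' _ + (lT x).mk' _).isLinear
  smul_mem' := by
    rintro c T ⟨⟨⟨D, hD, hT⟩, lT⟩, zT⟩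
    refine ⟨⟨⟨(‖c‖ + 1) * D, by positivity, fun x y e => ?_⟩, fun x => ?_⟩, fun e => by simp [zT]⟩
    · rw [Pi.smul_apply, Pi.smul_apply, ← smul_sub, norm_smul]
      calc ‖c‖ * ‖T (x, e) - T (y, e)‖ ≤ (‖c‖ + 1) * (D * dist x y * ‖e‖) :=
            mul_le_mul (by linarith) (hT x y e) (norm_nonneg _) (by positivity)
        _ = _ := by ring
    · exact (c • (lT x).mk' _).isLinear

variable {𝕜 X E F}

/-- `x ↦ T(x, ·)`, as an element of `Lip₀(X; 𝓛(E; F))`. -/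
def curryLip (T : LipLZero 𝕜 X E F) : LipZero 𝕜 X (E →L[𝕜] F) :=
  ⟨fun x => LinearMap.mkContinuousOfExistsBound ((T.2.1.2 x).mk' _) (by
      obtain ⟨C, hC, h⟩ := T.2.1.1
      refine ⟨C * dist x 0, fun e => ?_⟩
      have := h x 0 e
      rw [T.2.2 e, sub_zero] at this
      exact this),
    by ext e; exact T.2.2 e, by
      obtain ⟨C, hC, h⟩ := T.2.1.1
      exact ⟨C, fun x y => ContinuousLinearMap.opNorm_le_bound _ (by positivity) fun e => h x y e⟩⟩

/-- The bilinear operator `T_bil : 𝓕(X) × E → F` associated with `T`; it is the only continuous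
bilinear operator with `T_bil(δ_x, e) = T(x, e)` (see the next two facts). -/
def Tbil [CompleteSpace F] (T : LipLZero 𝕜 X E F) : LipFree 𝕜 X →L[𝕜] E →L[𝕜] F :=
  linearize (curryLip T)

theorem Tbil_delta [CompleteSpace F] (T : LipLZero 𝕜 X E F) (x : X) (e : E) :
    Tbil T (delta 𝕜 x) e = T.1 (x, e) := by
  rw [Tbil, linearize_delta]; rfl

theorem Tbil_unique [CompleteSpace F] (T : LipLZero 𝕜 X E F)
    (B : LipFree 𝕜 X →L[𝕜] E →L[𝕜] F) (hB : ∀ x e, B (delta 𝕜 x) e = T.1 (x, e)) :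
    B = Tbil T :=
  freeSpace_ext fun x => by ext e; rw [hB, Tbil_delta]

/-! ### Integral Lip-Linear operators -/

/-- `sup ‖∑ᵢ (f(xᵢ) - f(yᵢ)) e*(eᵢ) zᵢ*‖` over `f ∈ B_{X^#}` and `‖e*‖ = 1`. -/
def lipWeakSup {n : ℕ} (x y : Fin n → X) (e : Fin n → E) (z : Fin n → StrongDual 𝕜 F) : ℝ :=
  ⨆ p : {f : LipZero 𝕜 X 𝕜 // ‖f‖ ≤ 1} × {φ : StrongDual 𝕜 E // ‖φ‖ = 1},
    ‖∑ i, ((p.1.1 (x i) - p.1.1 (y i)) * p.2.1 (e i)) • z i‖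

variable (𝕜) in
/-- `C` satisfies the inequality that defines integrality of `T : X × E → F`. -/
def LipLIntBound (T : X × E → F) (C : ℝ) : Prop :=
  ∀ (n : ℕ) (x y : Fin n → X) (e : Fin n → E) (z : Fin n → StrongDual 𝕜 F),
    ‖∑ i, z i (T (x i, e i) - T (y i, e i))‖ ≤ C * lipWeakSup x y e z

variable (𝕜) in
/-- Integrality of a Lip-Linear operator. -/
def IsLipLIntegral (T : X × E → F) : Prop := ∃ C : ℝ, 0 < C ∧ LipLIntBound 𝕜 T C

variable (𝕜) in
/-- `𝔍_int^{LipL}(T)`. -/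
def lipLIntNorm (T : X × E → F) : ℝ := sInf {C : ℝ | 0 < C ∧ LipLIntBound 𝕜 T C}

theorem lipWeakSup_nonneg {n : ℕ} (x y : Fin n → X) (e : Fin n → E)
    (z : Fin n → StrongDual 𝕜 F) : 0 ≤ lipWeakSup x y e z :=
  Real.iSup_nonneg fun _ => norm_nonneg _

theorem LipLIntBound.mono {T : X × E → F} {C D : ℝ} (h : C ≤ D) (hT : LipLIntBound 𝕜 T C) :
    LipLIntBound 𝕜 T D := fun n x y e z =>
  (hT n x y e z).trans (mul_le_mul_of_nonneg_right h (lipWeakSup_nonneg x y e z))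

theorem LipLIntBound.zero : LipLIntBound 𝕜 (0 : X × E → F) 0 := fun n x y e z => by simp

theorem LipLIntBound.add {S T : X × E → F} {C D : ℝ} (hS : LipLIntBound 𝕜 S C)
    (hT : LipLIntBound 𝕜 T D) : LipLIntBound 𝕜 (S + T) (C + D) := fun n x y e z => by
  have : ∑ i, z i ((S + T) (x i, e i) - (S + T) (y i, e i)) =
      ∑ i, z i (S (x i, e i) - S (y i, e i)) + ∑ i, z i (T (x i, e i) - T (y i, e i)) := by
    rw [← Finset.sum_add_distrib]
    refine Finset.sum_congr rfl fun i _ => ?_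
    rw [← map_add]; congr 1; simp only [Pi.add_apply]; abel
  rw [this, add_mul]
  exact (norm_add_le _ _).trans (add_le_add (hS n x y e z) (hT n x y e z))

theorem LipLIntBound.smul (c : 𝕜) {T : X × E → F} {C : ℝ} (hT : LipLIntBound 𝕜 T C) :
    LipLIntBound 𝕜 (c • T) (‖c‖ * C) := fun n x y e z => by
  have : ∑ i, z i ((c • T) (x i, e i) - (c • T) (y i, e i)) =
      c * ∑ i, z i (T (x i, e i) - T (y i, e i)) := by
    rw [Finset.mul_sum]
    refine Finset.sum_congr rfl fun i _ => ?_
    rw [Pi.smul_apply, Pi.smul_apply, ← smul_sub, map_smul, smul_eq_mul]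
  rw [this, norm_mul, mul_assoc]
  exact mul_le_mul_of_nonneg_left (hT n x y e z) (norm_nonneg c)

theorem lipWeakSup_one_le (x y : X) (e : E) (z : StrongDual 𝕜 F) :
    lipWeakSup (fun _ : Fin 1 => x) (fun _ => y) (fun _ => e) (fun _ => z) ≤
      dist x y * ‖e‖ * ‖z‖ := by
  refine Real.iSup_le (fun p => ?_) (by positivity)
  rw [Fin.sum_univ_one, norm_smul, norm_mul]
  have h1 : ‖p.1.1 x - p.1.1 y‖ ≤ dist x y :=
    (p.1.1.norm_sub_le x y).trans (mul_le_of_le_one_left dist_nonneg p.1.2)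
  have h2 : ‖p.2.1 e‖ ≤ ‖e‖ := by
    have := p.2.1.le_opNorm e
    rwa [p.2.2, one_mul] at this
  gcongr

theorem LipLIntBound.eq_zero {T : X × E → F} (h0 : ∀ e, T (0, e) = 0)
    (h : ∀ C : ℝ, 0 < C → LipLIntBound 𝕜 T C) : T = 0 := by
  funext ⟨x, e⟩
  refine SeparatingDual.eq_zero_of_forall_dual_eq_zero (R := 𝕜) fun z => ?_
  refine norm_le_zero_iff.mp (le_of_forall_pos_le_add fun ε hε => ?_)
  set M := dist x 0 * ‖e‖ * ‖z‖ with hM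
  have hM0 : 0 ≤ M := by positivity
  have := h (ε / (M + 1)) (by positivity) 1 (fun _ => x) (fun _ => 0) (fun _ => e) (fun _ => z)
  rw [Fin.sum_univ_one, h0, sub_zero] at this
  refine this.trans ?_
  have h2 : ε / (M + 1) * lipWeakSup (fun _ : Fin 1 => x) (fun _ => 0) (fun _ => e) (fun _ => z)
      ≤ ε / (M + 1) * M := mul_le_mul_of_nonneg_left (lipWeakSup_one_le x 0 e z) (by positivity)
  refine h2.trans ?_
  rw [zero_add, div_mul_eq_mul_div, div_le_iff₀ (by positivity)]
  nlinarith

variable (𝕜 X E F)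

/-- The integral operators, as a linear subspace of `LipL₀(X × E; F)`. -/
def lipLIntSubmodule : Submodule 𝕜 (LipLZero 𝕜 X E F) where
  carrier := {T | IsLipLIntegral 𝕜 T.1}
  zero_mem' := ⟨1, one_pos, LipLIntBound.zero.mono zero_le_one⟩
  add_mem' := by
    rintro S T ⟨C, hC, hS⟩ ⟨D, hD, hT⟩
    exact ⟨C + D, by positivity, hS.add hT⟩
  smul_mem' := by
    rintro c T ⟨C, hC, hT⟩
    refine ⟨(‖c‖ + 1) * C, by positivity, (hT.smul c).mono ?_⟩
    exact mul_le_mul_of_nonneg_right (by linarith) hC.le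

/-- The space `LipL₀^int(X × E; F)`, normed by `𝔍_int^{LipL}`. -/
def LipLInt : Type _ := lipLIntSubmodule 𝕜 X E F

instance : AddCommGroup (LipLInt 𝕜 X E F) :=
  inferInstanceAs (AddCommGroup (lipLIntSubmodule 𝕜 X E F))
instance : Module 𝕜 (LipLInt 𝕜 X E F) := inferInstanceAs (Module 𝕜 (lipLIntSubmodule 𝕜 X E F))

variable {𝕜 X E F}

/-- The underlying element of `LipL₀(X × E; F)`. -/
def LipLInt.toLipLZero (T : LipLInt 𝕜 X E F) : LipLZero 𝕜 X E F := T.1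

instance : Norm (LipLInt 𝕜 X E F) := ⟨fun T => lipLIntNorm 𝕜 T.toLipLZero.1⟩

theorem LipLInt.core : NormedSpace.Core 𝕜 (LipLInt 𝕜 X E F) :=
  core_sInf (fun T C => LipLIntBound 𝕜 T.toLipLZero.1 C) (fun _ => rfl) (fun T => T.2)
    (fun _ _ _ _ hS hT => hS.add hT) (fun c _ _ hT => hT.smul c)
    (fun _ _ _ h hT => hT.mono h)
    (fun T h => Subtype.ext (Subtype.ext (LipLIntBound.eq_zero T.toLipLZero.2.2 h)))

instance : NormedAddCommGroup (LipLInt 𝕜 X E F) := NormedAddCommGroup.ofCore LipLInt.core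
instance : NormedSpace 𝕜 (LipLInt 𝕜 X E F) := NormedSpace.ofCore LipLInt.core

end LipLinear

/-! ## Integral bilinear operators -/

section Bilinear

variable (𝕜 E F G : Type*) [RCLike 𝕜]
  [NormedAddCommGroup E] [NormedSpace 𝕜 E] [NormedAddCommGroup F] [NormedSpace 𝕜 F]
  [NormedAddCommGroup G] [NormedSpace 𝕜 G]

variable {𝕜 E F G}

/-- `sup ‖∑ᵢ x*(xᵢ) y*(yᵢ) zᵢ*‖` over `x* ∈ B_{E*}` and `y* ∈ B_{F*}`. -/
def bilWeakSup {n : ℕ} (x : Fin n → E) (y : Fin n → F) (z : Fin n → StrongDual 𝕜 G) : ℝ :=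
  ⨆ p : {φ : StrongDual 𝕜 E // ‖φ‖ ≤ 1} × {ψ : StrongDual 𝕜 F // ‖ψ‖ ≤ 1},
    ‖∑ i, (p.1.1 (x i) * p.2.1 (y i)) • z i‖

/-- `C` satisfies the inequality that defines integrality of `B : E × F → G`. -/
def BilIntBound (B : E →L[𝕜] F →L[𝕜] G) (C : ℝ) : Prop :=
  ∀ (n : ℕ) (x : Fin n → E) (y : Fin n → F) (z : Fin n → StrongDual 𝕜 G),
    ‖∑ i, z i (B (x i) (y i))‖ ≤ C * bilWeakSup x y z

/-- Integrality of a bilinear operator. -/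
def IsBilIntegral (B : E →L[𝕜] F →L[𝕜] G) : Prop := ∃ C : ℝ, 0 < C ∧ BilIntBound B C

/-- `𝔍_int^2(B)`. -/
def bilIntNorm (B : E →L[𝕜] F →L[𝕜] G) : ℝ := sInf {C : ℝ | 0 < C ∧ BilIntBound B C}

theorem bilWeakSup_nonneg {n : ℕ} (x : Fin n → E) (y : Fin n → F)
    (z : Fin n → StrongDual 𝕜 G) : 0 ≤ bilWeakSup x y z :=
  Real.iSup_nonneg fun _ => norm_nonneg _

theorem BilIntBound.mono {B : E →L[𝕜] F →L[𝕜] G} {C D : ℝ} (h : C ≤ D) (hB : BilIntBound B C) :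
    BilIntBound B D := fun n x y z =>
  (hB n x y z).trans (mul_le_mul_of_nonneg_right h (bilWeakSup_nonneg x y z))

theorem BilIntBound.zero : BilIntBound (0 : E →L[𝕜] F →L[𝕜] G) 0 := fun n x y z => by simp

theorem BilIntBound.add {A B : E →L[𝕜] F →L[𝕜] G} {C D : ℝ} (hA : BilIntBound A C)
    (hB : BilIntBound B D) : BilIntBound (A + B) (C + D) := fun n x y z => by
  have : ∑ i, z i ((A + B) (x i) (y i)) =
      ∑ i, z i (A (x i) (y i)) + ∑ i, z i (B (x i) (y i)) := by
    simp [Finset.sum_add_distrib]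
  rw [this, add_mul]
  exact (norm_add_le _ _).trans (add_le_add (hA n x y z) (hB n x y z))

theorem BilIntBound.smul (c : 𝕜) {B : E →L[𝕜] F →L[𝕜] G} {C : ℝ} (hB : BilIntBound B C) :
    BilIntBound (c • B) (‖c‖ * C) := fun n x y z => by
  have : ∑ i, z i ((c • B) (x i) (y i)) = c * ∑ i, z i (B (x i) (y i)) := by
    simp [Finset.mul_sum]
  rw [this, norm_mul, mul_assoc]
  exact mul_le_mul_of_nonneg_left (hB n x y z) (norm_nonneg c)

theorem bilWeakSup_one_le (x : E) (y : F) (z : StrongDual 𝕜 G) :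
    bilWeakSup (fun _ : Fin 1 => x) (fun _ => y) (fun _ => z) ≤ ‖x‖ * ‖y‖ * ‖z‖ := by
  refine Real.iSup_le (fun p => ?_) (by positivity)
  rw [Fin.sum_univ_one, norm_smul, norm_mul]
  have h1 : ‖p.1.1 x‖ ≤ ‖x‖ :=
    (p.1.1.le_opNorm x).trans (mul_le_of_le_one_left (norm_nonneg x) p.1.2)
  have h2 : ‖p.2.1 y‖ ≤ ‖y‖ :=
    (p.2.1.le_opNorm y).trans (mul_le_of_le_one_left (norm_nonneg y) p.2.2)
  gcongr

theorem BilIntBound.eq_zero {B : E →L[𝕜] F →L[𝕜] G}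
    (h : ∀ C : ℝ, 0 < C → BilIntBound B C) : B = 0 := by
  ext x y
  refine SeparatingDual.eq_zero_of_forall_dual_eq_zero (R := 𝕜) fun z => ?_
  refine norm_le_zero_iff.mp (le_of_forall_pos_le_add fun ε hε => ?_)
  set M := ‖x‖ * ‖y‖ * ‖z‖ with hM
  have hM0 : 0 ≤ M := by positivity
  have := h (ε / (M + 1)) (by positivity) 1 (fun _ => x) (fun _ => y) (fun _ => z)
  rw [Fin.sum_univ_one] at this
  refine this.trans ?_
  have h2 : ε / (M + 1) * bilWeakSup (fun _ : Fin 1 => x) (fun _ => y) (fun _ => z)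
      ≤ ε / (M + 1) * M := mul_le_mul_of_nonneg_left (bilWeakSup_one_le x y z) (by positivity)
  refine h2.trans ?_
  rw [zero_add, div_mul_eq_mul_div, div_le_iff₀ (by positivity)]
  nlinarith

variable (𝕜 E F G)

/-- The integral operators, as a linear subspace of the continuous bilinear operators. -/
def bilIntSubmodule : Submodule 𝕜 (E →L[𝕜] F →L[𝕜] G) where
  carrier := {B | IsBilIntegral B}
  zero_mem' := ⟨1, one_pos, BilIntBound.zero.mono zero_le_one⟩
  add_mem' := by
    rintro A B ⟨C, hC, hA⟩ ⟨D, hD, hB⟩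
    exact ⟨C + D, by positivity, hA.add hB⟩
  smul_mem' := by
    rintro c B ⟨C, hC, hB⟩
    refine ⟨(‖c‖ + 1) * C, by positivity, (hB.smul c).mono ?_⟩
    exact mul_le_mul_of_nonneg_right (by linarith) hC.le

/-- The space `BI(E × F; G)`, normed by `𝔍_int^2`. -/
def BilInt : Type _ := bilIntSubmodule 𝕜 E F G

instance : AddCommGroup (BilInt 𝕜 E F G) := inferInstanceAs (AddCommGroup (bilIntSubmodule 𝕜 E F G))
instance : Module 𝕜 (BilInt 𝕜 E F G) := inferInstanceAs (Module 𝕜 (bilIntSubmodule 𝕜 E F G))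

variable {𝕜 E F G}

/-- The underlying continuous bilinear operator. -/
def BilInt.toBilinear (B : BilInt 𝕜 E F G) : E →L[𝕜] F →L[𝕜] G := B.1

instance : Norm (BilInt 𝕜 E F G) := ⟨fun B => bilIntNorm B.toBilinear⟩

theorem BilInt.core : NormedSpace.Core 𝕜 (BilInt 𝕜 E F G) :=
  core_sInf (fun B C => BilIntBound B.toBilinear C) (fun _ => rfl) (fun B => B.2)
    (fun _ _ _ _ hS hT => hS.add hT) (fun c _ _ hT => hT.smul c)
    (fun _ _ _ h hT => hT.mono h)
    (fun _ h => Subtype.ext (BilIntBound.eq_zero h))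

instance : NormedAddCommGroup (BilInt 𝕜 E F G) := NormedAddCommGroup.ofCore BilInt.core
instance : NormedSpace 𝕜 (BilInt 𝕜 E F G) := NormedSpace.ofCore BilInt.core

end Bilinear

/-! ## The Lipschitz injective tensor product -/

section Tensor

variable (𝕜 X E : Type*) [RCLike 𝕜] [MetricSpace X] [Zero X]
  [NormedAddCommGroup E] [NormedSpace 𝕜 E]

variable {X E} in
/-- The functional `δ_{(x,y)} ⊠ e` on `Lip₀(X; E*)`, `g ↦ ⟨g(x) - g(y), e⟩`. -/
def boxFunctional (x y : X) (e : E) : Module.Dual 𝕜 (LipZero 𝕜 X (StrongDual 𝕜 E)) where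
  toFun g := (g x - g y) e
  map_add' f g := by
    simp only [LipZero.add_apply, sub_apply, add_apply]; ring
  map_smul' c g := by
    simp only [LipZero.smul_apply, ← smul_sub, smul_apply, RingHom.id_apply]

/-- The linear span of the functionals `δ_{(x,y)} ⊠ e`. -/
def lipTensorSubmodule : Submodule 𝕜 (Module.Dual 𝕜 (LipZero 𝕜 X (StrongDual 𝕜 E))) :=
  Submodule.span 𝕜 (Set.range fun p : X × X × E => boxFunctional 𝕜 p.1 p.2.1 p.2.2)

/-- The Lipschitz tensor product `X ⊠ E`; below it is normed by the Lipschitz injective norm. -/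
def LipTensor : Type _ := lipTensorSubmodule 𝕜 X E

instance : AddCommGroup (LipTensor 𝕜 X E) :=
  inferInstanceAs (AddCommGroup (lipTensorSubmodule 𝕜 X E))
instance : Module 𝕜 (LipTensor 𝕜 X E) := inferInstanceAs (Module 𝕜 (lipTensorSubmodule 𝕜 X E))

variable {𝕜 X E}

variable (𝕜) in
/-- `δ_{(x,y)} ⊠ e` as an element of `X ⊠ E`. -/
def box (x y : X) (e : E) : LipTensor 𝕜 X E :=
  ⟨boxFunctional 𝕜 x y e, Submodule.subset_span ⟨(x, y, e), rfl⟩⟩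

/-- The underlying functional on `Lip₀(X; E*)`. -/
def LipTensor.toDual : LipTensor 𝕜 X E →ₗ[𝕜] Module.Dual 𝕜 (LipZero 𝕜 X (StrongDual 𝕜 E)) :=
  (lipTensorSubmodule 𝕜 X E).subtype

/-- The element `x ↦ f(x) e*` of `Lip₀(X; E*)`. -/
def elem (f : LipZero 𝕜 X 𝕜) (φ : StrongDual 𝕜 E) : LipZero 𝕜 X (StrongDual 𝕜 E) :=
  LipZero.mk (fun x => f x • φ)
    ((congrArg (· • φ) f.map_zero).trans (zero_smul 𝕜 φ)) (‖f‖ * ‖φ‖) (fun x y => by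
      rw [← (sub_smul (f x) (f y) φ : _ = f x • φ - f y • φ)]
      refine (norm_smul (f x - f y) φ).le.trans ?_
      rw [mul_right_comm]
      exact mul_le_mul_of_nonneg_right (f.norm_sub_le x y) (norm_nonneg φ))

theorem toDual_box_elem (x y : X) (e : E) (f : LipZero 𝕜 X 𝕜) (φ : StrongDual 𝕜 E) :
    (box 𝕜 x y e).toDual (elem f φ) = (f x - f y) * φ e := by
  change f x * φ e - f y * φ e = _
  ring

/-- The Lipschitz injective norm: for `u = ∑ᵢ δ_{(xᵢ,yᵢ)} ⊠ eᵢ` the number `u (f · e*)` equals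
`∑ᵢ (f(xᵢ) - f(yᵢ)) e*(eᵢ)`, see `LipTensor.norm_sum_box`. -/
instance : Norm (LipTensor 𝕜 X E) :=
  ⟨fun u => ⨆ p : {f : LipZero 𝕜 X 𝕜 // ‖f‖ ≤ 1} × {φ : StrongDual 𝕜 E // ‖φ‖ = 1},
    ‖u.toDual (elem p.1.1 p.2.1)‖⟩

theorem LipTensor.norm_def (u : LipTensor 𝕜 X E) :
    ‖u‖ = ⨆ p : {f : LipZero 𝕜 X 𝕜 // ‖f‖ ≤ 1} × {φ : StrongDual 𝕜 E // ‖φ‖ = 1},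
      ‖u.toDual (elem p.1.1 p.2.1)‖ := rfl

theorem LipTensor.norm_sum_box {n : ℕ} (x y : Fin n → X) (e : Fin n → E) :
    ‖∑ i, box 𝕜 (x i) (y i) (e i)‖ =
      ⨆ p : {f : LipZero 𝕜 X 𝕜 // ‖f‖ ≤ 1} × {φ : StrongDual 𝕜 E // ‖φ‖ = 1},
        ‖∑ i, (p.1.1 (x i) - p.1.1 (y i)) * p.2.1 (e i)‖ := by
  rw [LipTensor.norm_def]
  congr 1; ext p
  rw [map_sum, LinearMap.sum_apply]
  simp only [toDual_box_elem]

theorem LipTensor.exists_rep (u : LipTensor 𝕜 X E) :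
    ∃ (n : ℕ) (x y : Fin n → X) (e : Fin n → E), u = ∑ i, box 𝕜 (x i) (y i) (e i) := by
  have key : ∀ v ∈ lipTensorSubmodule 𝕜 X E,
      ∃ (n : ℕ) (x y : Fin n → X) (e : Fin n → E),
        v = ∑ i, boxFunctional 𝕜 (x i) (y i) (e i) := by
    intro v hv
    induction hv using Submodule.span_induction with
    | mem v h =>
      obtain ⟨⟨x, y, e⟩, rfl⟩ := h
      exact ⟨1, fun _ => x, fun _ => y, fun _ => e, by simp⟩
    | zero => exact ⟨0, Fin.elim0, Fin.elim0, Fin.elim0, by simp⟩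
    | add v w _ _ hv hw =>
      obtain ⟨n, x, y, e, rfl⟩ := hv
      obtain ⟨m, x', y', e', rfl⟩ := hw
      exact ⟨n + m, Fin.append x x', Fin.append y y', Fin.append e e', by
        simp [Fin.sum_univ_add]⟩
    | smul c v _ hv =>
      obtain ⟨n, x, y, e, rfl⟩ := hv
      refine ⟨n, x, y, fun i => c • e i, ?_⟩
      rw [Finset.smul_sum]
      refine Finset.sum_congr rfl fun i _ => LinearMap.ext fun g => ?_
      exact (map_smul (g (x i) - g (y i)) c (e i)).symm
  obtain ⟨n, x, y, e, h⟩ := key u.1 u.2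
  refine ⟨n, x, y, e, Subtype.ext (h.trans ?_)⟩
  change _ = LipTensor.toDual (∑ i, box 𝕜 (x i) (y i) (e i))
  rw [map_sum]; rfl

theorem LipTensor.bdd (u : LipTensor 𝕜 X E) :
    BddAbove (Set.range fun p : {f : LipZero 𝕜 X 𝕜 // ‖f‖ ≤ 1} × {φ : StrongDual 𝕜 E // ‖φ‖ = 1} =>
      ‖u.toDual (elem p.1.1 p.2.1)‖) := by
  obtain ⟨n, x, y, e, rfl⟩ := u.exists_rep
  refine ⟨∑ i, dist (x i) (y i) * ‖e i‖, ?_⟩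
  rintro _ ⟨p, rfl⟩
  simp only [map_sum, LinearMap.sum_apply, toDual_box_elem]
  refine (norm_sum_le _ _).trans (Finset.sum_le_sum fun i _ => ?_)
  rw [norm_mul]
  have h1 : ‖p.1.1 (x i) - p.1.1 (y i)‖ ≤ dist (x i) (y i) :=
    (p.1.1.norm_sub_le _ _).trans (mul_le_of_le_one_left dist_nonneg p.1.2)
  have h2 : ‖p.2.1 (e i)‖ ≤ ‖e i‖ := by
    have := p.2.1.le_opNorm (e i)
    rwa [p.2.2, one_mul] at this
  gcongr

theorem elem_smul (c d : 𝕜) (f : LipZero 𝕜 X 𝕜) (φ : StrongDual 𝕜 E) :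
    elem (c • f) (d • φ) = (c * d) • elem f φ := by
  refine LipZero.ext fun x => ?_
  change (c * f x) • d • φ = (c * d) • f x • φ
  rw [smul_smul, smul_smul, mul_right_comm]

theorem LipTensor.elem_eq_zero {u : LipTensor 𝕜 X E} (hu : ‖u‖ = 0)
    (f : LipZero 𝕜 X 𝕜) (φ : StrongDual 𝕜 E) : u.toDual (elem f φ) = 0 := by
  by_cases hf : f = 0
  · subst hf
    have : elem (0 : LipZero 𝕜 X 𝕜) φ = 0 := LipZero.ext fun x => zero_smul 𝕜 φ
    rw [this, map_zero]
  by_cases hφ : φ = 0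
  · subst hφ
    have : elem f (0 : StrongDual 𝕜 E) = 0 := LipZero.ext fun x => smul_zero (A := StrongDual 𝕜 E) (f x)
    rw [this, map_zero]
  have hf' : (‖f‖ : 𝕜) ≠ 0 := by simpa using hf
  have hφ' : (‖φ‖ : 𝕜) ≠ 0 := by simpa using hφ
  have h := le_ciSup u.bdd (⟨(‖f‖ : 𝕜)⁻¹ • f, (norm_smul_inv_norm hf).le⟩,
    ⟨(‖φ‖ : 𝕜)⁻¹ • φ, norm_smul_inv_norm hφ⟩)
  rw [← LipTensor.norm_def, hu] at h
  have h' := norm_le_zero_iff.mp h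
  simp only [elem_smul, map_smul, smul_eq_mul] at h'
  exact (mul_eq_zero.mp h').resolve_left (mul_ne_zero (inv_ne_zero hf') (inv_ne_zero hφ'))

theorem LipTensor.eq_zero {u : LipTensor 𝕜 X E} (hu : ‖u‖ = 0) : u = 0 := by
  obtain ⟨n, x, y, e, hrep⟩ := u.exists_rep
  let S : Submodule 𝕜 E := Submodule.span 𝕜 (Set.range e)
  have : FiniteDimensional 𝕜 S := FiniteDimensional.span_of_finite 𝕜 (Set.finite_range e)
  let b := Module.finBasis 𝕜 S
  have hmem : ∀ i, e i ∈ S := fun i => Submodule.subset_span ⟨i, rfl⟩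
  choose ψ hψ using fun k => exists_extension_norm_eq S (LinearMap.toContinuousLinearMap (b.coord k))
  have hψ' : ∀ k (s : S), ψ k s = b.repr s k := fun k s => (hψ k).1 s
  refine Subtype.ext (LinearMap.ext fun g => ?_)
  let gk : Fin (Module.finrank 𝕜 S) → LipZero 𝕜 X 𝕜 := fun k =>
    LipZero.mk (fun t => g t (b k)) (by simp) (‖g‖ * ‖(b k : E)‖) (fun s t => by
      rw [mul_right_comm]
      exact ((g s - g t).le_opNorm _).trans
        (mul_le_mul_of_nonneg_right (g.norm_sub_le s t) (norm_nonneg _)))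
  have hsum : u.toDual g = ∑ k, u.toDual (elem (gk k) (ψ k)) := by
    rw [hrep]
    simp only [map_sum, LinearMap.sum_apply, toDual_box_elem]
    rw [Finset.sum_comm]
    refine Finset.sum_congr rfl fun i _ => ?_
    have he : e i = ∑ k, ψ k (e i) • (b k : E) := by
      have := congrArg (Subtype.val) (b.sum_repr ⟨e i, hmem i⟩)
      rw [Submodule.coe_sum] at this
      refine this.symm.trans (Finset.sum_congr rfl fun k _ => ?_)
      rw [show ψ k (e i) = b.repr ⟨e i, hmem i⟩ k from hψ' k ⟨e i, hmem i⟩]; rfl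
    change (g (x i) - g (y i)) (e i) = _
    conv_lhs => rw [he]
    rw [map_sum]
    refine Finset.sum_congr rfl fun k _ => ?_
    rw [map_smul, smul_eq_mul, mul_comm]; rfl
  change u.toDual g = 0
  rw [hsum]
  exact Finset.sum_eq_zero fun k _ => LipTensor.elem_eq_zero hu _ _

theorem LipTensor.core : NormedSpace.Core 𝕜 (LipTensor 𝕜 X E) where
  norm_nonneg u := Real.iSup_nonneg fun _ => norm_nonneg _
  norm_smul c u := by
    rw [LipTensor.norm_def, LipTensor.norm_def, Real.mul_iSup_of_nonneg (norm_nonneg c)]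
    congr 1; ext p
    rw [map_smul, LinearMap.smul_apply, norm_smul]
  norm_triangle u v := by
    refine Real.iSup_le (fun p => ?_) (add_nonneg (Real.iSup_nonneg fun _ => norm_nonneg _)
      (Real.iSup_nonneg fun _ => norm_nonneg _))
    rw [map_add, LinearMap.add_apply]
    exact (norm_add_le _ _).trans (add_le_add (le_ciSup u.bdd p) (le_ciSup v.bdd p))
  norm_eq_zero_iff u := ⟨LipTensor.eq_zero, fun h => by
    subst h
    rw [LipTensor.norm_def]
    simp⟩

instance : NormedAddCommGroup (LipTensor 𝕜 X E) := NormedAddCommGroup.ofCore LipTensor.core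
instance : NormedSpace 𝕜 (LipTensor 𝕜 X E) := NormedSpace.ofCore LipTensor.core

variable (𝕜 X E) in
/-- `X ⊠̂_ε E`: the completion of `X ⊠ E` for the Lipschitz injective norm. -/
abbrev InjLipTensor : Type _ := UniformSpace.Completion (LipTensor 𝕜 X E)

end Tensor

end LipLin

end

namespace LipLin

/-! ## Generalities -/

theorem sInf_eq_of_bound_iff {P : ℝ → Prop} {a : ℝ} (ha : 0 ≤ a)
    (h : ∀ C, 0 ≤ C → (P C ↔ a ≤ C)) : sInf {C : ℝ | 0 < C ∧ P C} = a := by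
  have hne : {C : ℝ | 0 < C ∧ P C}.Nonempty :=
    ⟨a + 1, by positivity, (h _ (by positivity)).2 (by linarith)⟩
  -- The slack `ε` covers `a = 0`, which is not in the set because its members are strictly
  -- positive.
  refine le_antisymm (le_of_forall_pos_le_add fun ε hε => ?_)
    (le_csInf hne fun C hC => (h C hC.1.le).1 hC.2)
  exact csInf_le ⟨0, fun C hC => hC.1.le⟩
    ⟨by positivity, (h _ (by positivity)).2 (by linarith)⟩

section

variable {𝕜 X E F : Type*} [RCLike 𝕜] [MetricSpace X] [Zero X]
  [NormedAddCommGroup E] [NormedSpace 𝕜 E] [NormedAddCommGroup F] [NormedSpace 𝕜 F]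

theorem LipZero.norm_apply_sub_le_dist {f : LipZero 𝕜 X 𝕜} (hf : ‖f‖ ≤ 1) (x y : X) :
    ‖f x - f y‖ ≤ dist x y :=
  (f.norm_sub_le x y).trans (mul_le_of_le_one_left dist_nonneg hf)

theorem norm_apply_le_of_norm_le_one {φ : StrongDual 𝕜 E} (hφ : ‖φ‖ ≤ 1) (e : E) :
    ‖φ e‖ ≤ ‖e‖ :=
  (φ.le_opNorm e).trans (mul_le_of_le_one_left (norm_nonneg e) hφ)

/-! ## The weak suprema -/

/-- A real `⨆` takes the value `0` on an unbounded family, so boundedness is required before any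
term can be compared with the supremum. -/
theorem lipWeakSup_bdd {n : ℕ} (x y : Fin n → X) (e : Fin n → E) (z : Fin n → StrongDual 𝕜 F) :
    BddAbove (Set.range fun
      p : {f : LipZero 𝕜 X 𝕜 // ‖f‖ ≤ 1} × {φ : StrongDual 𝕜 E // ‖φ‖ = 1} =>
        ‖∑ i, ((p.1.1 (x i) - p.1.1 (y i)) * p.2.1 (e i)) • z i‖) := by
  refine ⟨∑ i, dist (x i) (y i) * ‖e i‖ * ‖z i‖, ?_⟩
  rintro _ ⟨p, rfl⟩
  refine (norm_sum_le _ _).trans (Finset.sum_le_sum fun i _ => ?_)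
  rw [norm_smul, norm_mul]
  have h1 := LipZero.norm_apply_sub_le_dist p.1.2 (x i) (y i)
  have h2 := norm_apply_le_of_norm_le_one p.2.2.le (e i)
  gcongr

theorem bilWeakSup_bdd {G : Type*} [NormedAddCommGroup G] [NormedSpace 𝕜 G]
    {n : ℕ} (x : Fin n → G) (y : Fin n → E) (z : Fin n → StrongDual 𝕜 F) :
    BddAbove (Set.range fun
      p : {φ : StrongDual 𝕜 G // ‖φ‖ ≤ 1} × {ψ : StrongDual 𝕜 E // ‖ψ‖ ≤ 1} =>
        ‖∑ i, (p.1.1 (x i) * p.2.1 (y i)) • z i‖) := by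
  refine ⟨∑ i, ‖x i‖ * ‖y i‖ * ‖z i‖, ?_⟩
  rintro _ ⟨p, rfl⟩
  refine (norm_sum_le _ _).trans (Finset.sum_le_sum fun i _ => ?_)
  rw [norm_smul, norm_mul]
  have h1 := norm_apply_le_of_norm_le_one p.1.2 (x i)
  have h2 := norm_apply_le_of_norm_le_one p.2.2 (y i)
  gcongr

/-- The supremum over the unit sphere of `E*` also bounds the values on the unit ball. -/
theorem le_lipWeakSup {n : ℕ} (x y : Fin n → X) (e : Fin n → E) (z : Fin n → StrongDual 𝕜 F)
    {f : LipZero 𝕜 X 𝕜} (hf : ‖f‖ ≤ 1) {φ : StrongDual 𝕜 E} (hφ : ‖φ‖ ≤ 1) :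
    ‖∑ i, ((f (x i) - f (y i)) * φ (e i)) • z i‖ ≤ lipWeakSup x y e z := by
  -- The zero functional cannot be normalised; nonnegativity of the supremum suffices here, even
  -- when `E = 0` and the sphere is empty.
  by_cases h0 : φ = 0
  · subst h0
    have hz : ∀ i, ((f (x i) - f (y i)) * (0 : StrongDual 𝕜 E) (e i)) • z i = 0 := fun i => by
      rw [zero_apply, mul_zero]
      exact zero_smul 𝕜 (z i)
    rw [Finset.sum_eq_zero fun i _ => hz i, norm_zero]
    exact lipWeakSup_nonneg x y e z
  have h0' : (‖φ‖ : 𝕜) ≠ 0 := by simpa using h0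
  have h := le_ciSup (lipWeakSup_bdd x y e z)
    (⟨f, hf⟩, ⟨(‖φ‖ : 𝕜)⁻¹ • φ, norm_smul_inv_norm h0⟩)
  refine le_trans ?_ h
  -- The sum is homogeneous in `φ`: it is `‖φ‖ ≤ 1` times its value at the normalised functional.
  have heq : ∑ i, ((f (x i) - f (y i)) * φ (e i)) • z i =
      (‖φ‖ : 𝕜) • ∑ i, ((f (x i) - f (y i)) * ((‖φ‖ : 𝕜)⁻¹ • φ) (e i)) • z i := by
    rw [Finset.smul_sum]
    refine Finset.sum_congr rfl fun i _ => ?_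
    rw [smul_smul, smul_apply, smul_eq_mul]
    congr 1
    field_simp
  rw [heq, norm_smul, RCLike.norm_coe_norm]
  exact mul_le_of_le_one_left (norm_nonneg _) hφ

theorem le_bilWeakSup {G : Type*} [NormedAddCommGroup G] [NormedSpace 𝕜 G]
    {n : ℕ} (x : Fin n → G) (y : Fin n → E) (z : Fin n → StrongDual 𝕜 F)
    {φ : StrongDual 𝕜 G} (hφ : ‖φ‖ ≤ 1) {ψ : StrongDual 𝕜 E} (hψ : ‖ψ‖ ≤ 1) :
    ‖∑ i, (φ (x i) * ψ (y i)) • z i‖ ≤ bilWeakSup x y z :=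
  le_ciSup (bilWeakSup_bdd x y z) (⟨φ, hφ⟩, ⟨ψ, hψ⟩)

/-- Test functionals have norm at most `1`, so perturbing the first entries costs no more than the
size of the perturbation. This continuity is used in the density argument. -/
theorem bilWeakSup_le_add_sub {G : Type*} [NormedAddCommGroup G] [NormedSpace 𝕜 G]
    {n : ℕ} (x x' : Fin n → G) (y : Fin n → E) (z : Fin n → StrongDual 𝕜 F) :
    bilWeakSup x' y z ≤ bilWeakSup x y z + ∑ i, ‖x' i - x i‖ * ‖y i‖ * ‖z i‖ := by
  have hb := bilWeakSup_nonneg x y z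
  refine Real.iSup_le (fun p => ?_) (by positivity)
  have heq : ∑ i, (p.1.1 (x' i) * p.2.1 (y i)) • z i =
      ∑ i, (p.1.1 (x i) * p.2.1 (y i)) • z i + ∑ i, (p.1.1 (x' i - x i) * p.2.1 (y i)) • z i := by
    rw [← Finset.sum_add_distrib]
    refine Finset.sum_congr rfl fun i _ => ?_
    refine Eq.trans ?_ (add_smul _ _ (z i))
    rw [map_sub]
    congr 1
    ring
  rw [heq]
  refine (norm_add_le _ _).trans (add_le_add (le_bilWeakSup x y z p.1.2 p.2.2) ?_)
  refine (norm_sum_le _ _).trans (Finset.sum_le_sum fun i _ => ?_)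
  rw [norm_smul, norm_mul]
  have h1 := norm_apply_le_of_norm_le_one p.1.2 (x' i - x i)
  have h2 := norm_apply_le_of_norm_le_one p.2.2 (y i)
  gcongr

/-- The defining inequality of integrality, for families over an arbitrary finite index type. -/
theorem LipLIntBound.le_of_fintype {T : X × E → F} {C : ℝ} (hC : 0 ≤ C) (hT : LipLIntBound 𝕜 T C)
    {ι : Type*} [Fintype ι] (x y : ι → X) (e : ι → E) (z : ι → StrongDual 𝕜 F) {D : ℝ}
    (hD : 0 ≤ D) (h : ∀ (f : LipZero 𝕜 X 𝕜) (φ : StrongDual 𝕜 E), ‖f‖ ≤ 1 → ‖φ‖ ≤ 1 →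
      ‖∑ i, ((f (x i) - f (y i)) * φ (e i)) • z i‖ ≤ D) :
    ‖∑ i, z i (T (x i, e i) - T (y i, e i))‖ ≤ C * D := by
  let g := (Fintype.equivFin ι).symm
  have h1 := hT _ (x ∘ g) (y ∘ g) (e ∘ g) (z ∘ g)
  simp only [Function.comp_apply] at h1
  rw [g.sum_comp fun i => z i (T (x i, e i) - T (y i, e i))] at h1
  refine h1.trans (mul_le_mul_of_nonneg_left (Real.iSup_le (fun p => ?_) hD) hC)
  simp only [Function.comp_apply]
  rw [g.sum_comp fun i => ((p.1.1 (x i) - p.1.1 (y i)) * p.2.1 (e i)) • z i]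
  exact h _ _ p.1.2 p.2.2.le

/-! ## The Lipschitz-free space -/

theorem delta_zero : delta 𝕜 (0 : X) = 0 :=
  Subtype.ext (ContinuousLinearMap.ext fun f => f.map_zero)

theorem norm_delta_sub_le (x y : X) : ‖delta 𝕜 x - delta 𝕜 y‖ ≤ dist x y := by
  change ‖evalDual 𝕜 x - evalDual 𝕜 y‖ ≤ _
  refine ContinuousLinearMap.opNorm_le_bound _ dist_nonneg fun f => ?_
  rw [mul_comm]
  exact f.norm_sub_le x y

/-- The functional on `𝓕(X)` given by `f ∈ X^#`. -/
noncomputable def lipToDual (f : LipZero 𝕜 X 𝕜) : StrongDual 𝕜 (LipFree 𝕜 X) :=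
  (ContinuousLinearMap.apply 𝕜 𝕜 f).comp (LipFree.incl 𝕜 X)

theorem lipToDual_delta (f : LipZero 𝕜 X 𝕜) (x : X) : lipToDual f (delta 𝕜 x) = f x := rfl

theorem norm_lipToDual_le (f : LipZero 𝕜 X 𝕜) : ‖lipToDual f‖ ≤ ‖f‖ :=
  ContinuousLinearMap.opNorm_le_bound _ (norm_nonneg f) fun m =>
    ((LipFree.incl 𝕜 X m).le_opNorm f).trans_eq (mul_comm _ _)

/-- The function `x ↦ φ(δ_x)` given by a functional `φ` on `𝓕(X)`. -/
noncomputable def dualToLip (φ : StrongDual 𝕜 (LipFree 𝕜 X)) : LipZero 𝕜 X 𝕜 :=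
  LipZero.mk (fun x => φ (delta 𝕜 x)) (by rw [delta_zero, map_zero]) ‖φ‖ fun x y => by
    rw [← map_sub]
    exact φ.le_opNorm_of_le (norm_delta_sub_le x y)

/-- With `norm_lipToDual_le`, this lets a test function on either side be replaced by one on the
other without loss in the constant. -/
theorem norm_dualToLip_le (φ : StrongDual 𝕜 (LipFree 𝕜 X)) : ‖dualToLip φ‖ ≤ ‖φ‖ :=
  LipZero.norm_le _ (norm_nonneg φ) fun x y => by
    change ‖φ (delta 𝕜 x) - φ (delta 𝕜 y)‖ ≤ _
    rw [← map_sub]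
    exact φ.le_opNorm_of_le (norm_delta_sub_le x y)

/-- Density is built into `freeSpace`; the `Finsupp` form keeps the coefficients accessible. -/
theorem LipFree.exists_finsupp_near (m : LipFree 𝕜 X) {ε : ℝ} (hε : 0 < ε) :
    ∃ a : X →₀ 𝕜, ‖(a.sum fun x c => c • delta 𝕜 x) - m‖ < ε := by
  have hm := m.2
  unfold freeSpace at hm
  rw [← SetLike.mem_coe, Submodule.topologicalClosure_coe, Metric.mem_closure_iff] at hm
  obtain ⟨b, hb, hd⟩ := hm ε hε
  obtain ⟨a, rfl⟩ := Finsupp.mem_span_range_iff_exists_finsupp.1 hb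
  refine ⟨a, ?_⟩
  rw [dist_comm, dist_eq_norm] at hd
  change ‖LipFree.incl 𝕜 X ((a.sum fun x c => c • delta 𝕜 x) - m)‖ < ε
  rw [map_sub, map_finsuppSum]
  exact hd

/-! ## Integrality of `T` and of `T_bil` -/

section Correspondence

variable [CompleteSpace F] (T : LipLZero 𝕜 X E F)

/-- Specialise the bilinear inequality to `δ_x - δ_y`; a functional in the unit ball of `𝓕(X)*` acts
on these through `dualToLip`. -/
theorem LipLIntBound.of_Tbil {C : ℝ} (hC : 0 ≤ C) (h : BilIntBound (Tbil T) C) :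
    LipLIntBound 𝕜 T.1 C := fun n x y e z => by
  have h1 := h n (fun i => delta 𝕜 (x i) - delta 𝕜 (y i)) e z
  simp only [map_sub, sub_apply, Tbil_delta] at h1
  simp only [map_sub]
  refine h1.trans (mul_le_mul_of_nonneg_left (Real.iSup_le (fun p => ?_)
    (lipWeakSup_nonneg x y e z)) hC)
  simp only [map_sub]
  exact le_lipWeakSup x y e z ((norm_dualToLip_le p.1.1).trans p.1.2) p.2.2

/-- Each coefficient `a i x` passes into the second variable by linearity of `T(x, ·)`, and taking
`0` as second point is harmless because `T(0, ·) = 0`. -/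
theorem LipLIntBound.Tbil_le_of_finsupp {C : ℝ} (hC : 0 ≤ C) (h : LipLIntBound 𝕜 T.1 C) {n : ℕ}
    (a : Fin n → X →₀ 𝕜) (e : Fin n → E) (z : Fin n → StrongDual 𝕜 F) :
    ‖∑ i, z i (Tbil T ((a i).sum fun x c => c • delta 𝕜 x) (e i))‖ ≤
      C * bilWeakSup (fun i => (a i).sum fun x c => c • delta 𝕜 x) e z := by
  -- One term for each index `i` and each point carrying a nonzero coefficient of the `i`-th
  -- combination.
  let ι := Σ i : Fin n, (a i).support
  have key := h.le_of_fintype hC (ι := ι) (fun s => s.2) (fun _ => 0)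
    (fun s => a s.1 s.2 • e s.1) (fun s => z s.1)
    (bilWeakSup_nonneg (fun i => (a i).sum fun x c => c • delta 𝕜 x) e z) ?_
  · refine le_of_eq_of_le (congrArg norm ?_) key
    rw [Fintype.sum_sigma]
    refine Finset.sum_congr rfl fun i _ => ?_
    rw [Finset.sum_coe_sort (a i).support
      fun x => z i (T.1 (x, a i x • e i) - T.1 (0, a i x • e i)), Finsupp.sum, map_sum,
      sum_apply, map_sum]
    refine Finset.sum_congr rfl fun x _ => ?_
    rw [T.2.2, sub_zero, (T.2.1.2 x).map_smul, map_smul (Tbil T), smul_apply,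
      Tbil_delta]
  -- Since `f 0 = 0`, summing over the support of `a i` reassembles `lipToDual f` at the `i`-th
  -- combination.
  · intro f φ hf hφ
    refine le_of_eq_of_le (congrArg norm ?_)
      (le_bilWeakSup (fun i => (a i).sum fun x c => c • delta 𝕜 x) e z
        ((norm_lipToDual_le f).trans hf) hφ)
    rw [Fintype.sum_sigma]
    refine Finset.sum_congr rfl fun i _ => ?_
    rw [Finset.sum_coe_sort (a i).support
      fun x => ((f x - f 0) * φ (a i x • e i)) • z i, Finsupp.sum, map_sum, Finset.sum_mul]
    refine Eq.trans ?_ (Finset.sum_smul (x := z i)).symm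
    refine Finset.sum_congr rfl fun x _ => ?_
    rw [f.map_zero, sub_zero, map_smul, map_smul, lipToDual_delta, smul_eq_mul, smul_eq_mul]
    congr 1
    ring

theorem LipLIntBound.to_Tbil {C : ℝ} (hC : 0 ≤ C) (h : LipLIntBound 𝕜 T.1 C) :
    BilIntBound (Tbil T) C := fun n m e z => by
  -- `K` is the total error per unit of approximation: the first sum is the change on the left side,
  -- the second the change of the weak supremum, multiplied by `C`. Dividing `ε` by `K + 1` below
  -- avoids a zero denominator.
  set K := ∑ i, ‖z i‖ * (‖Tbil T‖ * ‖e i‖) + C * ∑ i, ‖e i‖ * ‖z i‖ with hK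
  have hK0 : 0 ≤ K := by positivity
  refine le_of_forall_pos_le_add fun ε hε => ?_
  have hδ : 0 < ε / (K + 1) := by positivity
  set δ := ε / (K + 1)
  choose a ha using fun i => (m i).exists_finsupp_near hδ
  set m' : Fin n → LipFree 𝕜 X := fun i => (a i).sum fun x c => c • delta 𝕜 x with hm'
  have h1 : ‖∑ i, z i (Tbil T (m' i) (e i))‖ ≤ C * bilWeakSup m' e z :=
    h.Tbil_le_of_finsupp T hC a e z
  have h2 : bilWeakSup m' e z ≤ bilWeakSup m e z + δ * ∑ i, ‖e i‖ * ‖z i‖ := by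
    refine (bilWeakSup_le_add_sub m m' e z).trans (add_le_add le_rfl ?_)
    rw [Finset.mul_sum]
    refine Finset.sum_le_sum fun i _ => ?_
    rw [← mul_assoc]
    have := (ha i).le
    gcongr
  have h3 : ‖∑ i, z i (Tbil T (m i) (e i))‖ ≤
      ‖∑ i, z i (Tbil T (m' i) (e i))‖ + δ * ∑ i, ‖z i‖ * (‖Tbil T‖ * ‖e i‖) := by
    have heq : ∑ i, z i (Tbil T (m i) (e i)) =
        ∑ i, z i (Tbil T (m' i) (e i)) - ∑ i, z i (Tbil T (m' i - m i) (e i)) := by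
      simp only [map_sub, sub_apply, Finset.sum_sub_distrib, sub_sub_cancel]
    rw [heq]
    refine (norm_sub_le _ _).trans (add_le_add le_rfl ((norm_sum_le _ _).trans ?_))
    rw [Finset.mul_sum]
    refine Finset.sum_le_sum fun i _ => ?_
    calc ‖z i (Tbil T (m' i - m i) (e i))‖ ≤ ‖z i‖ * (‖Tbil T‖ * δ * ‖e i‖) :=
          (z i).le_opNorm_of_le ((Tbil T).le_of_opNorm₂_le_of_le le_rfl (ha i).le le_rfl)
      _ = _ := by ring
  have h4 : δ * K ≤ ε := by
    rw [div_mul_eq_mul_div, div_le_iff₀ (by positivity)]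
    nlinarith
  have h5 := mul_le_mul_of_nonneg_left h2 hC
  rw [hK] at h4
  linarith

/-- Stated for each fixed constant, so that the sets of admissible constants coincide; integrality
and the norms are then compared at once. -/
theorem lipLIntBound_iff_Tbil {C : ℝ} (hC : 0 ≤ C) :
    LipLIntBound 𝕜 T.1 C ↔ BilIntBound (Tbil T) C :=
  ⟨LipLIntBound.to_Tbil T hC, LipLIntBound.of_Tbil T hC⟩

theorem isLipLIntegral_iff_Tbil : IsLipLIntegral 𝕜 T.1 ↔ IsBilIntegral (Tbil T) :=
  exists_congr fun _ => and_congr_right fun hC => lipLIntBound_iff_Tbil T hC.le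

theorem lipLIntNorm_eq_Tbil : lipLIntNorm 𝕜 T.1 = bilIntNorm (Tbil T) :=
  congrArg sInf (Set.ext fun _ => and_congr_right fun hC => lipLIntBound_iff_Tbil T hC.le)

/-- The Lip-Linear operator `(x, e) ↦ B(δ_x, e)`. -/
noncomputable def ofBil (B : LipFree 𝕜 X →L[𝕜] E →L[𝕜] F) : LipLZero 𝕜 X E F :=
  -- The `+ 1` provides the strictly positive constant that `IsLipLinear` requires, also when `B =
  -- 0`.
  ⟨fun p => B (delta 𝕜 p.1) p.2, ⟨⟨‖B‖ + 1, by positivity, fun x y e => by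
      change ‖B (delta 𝕜 x) e - B (delta 𝕜 y) e‖ ≤ _
      rw [← sub_apply, ← map_sub]
      exact B.le_of_opNorm₂_le_of_le (by linarith) (norm_delta_sub_le x y) le_rfl⟩,
    fun x => (B (delta 𝕜 x)).toLinearMap.isLinear⟩, fun e => by
      change B (delta 𝕜 0) e = 0
      rw [delta_zero, map_zero, zero_apply]⟩

theorem Tbil_ofBil (B : LipFree 𝕜 X →L[𝕜] E →L[𝕜] F) : Tbil (ofBil B) = B :=
  (Tbil_unique _ B fun _ _ => rfl).symm

variable (𝕜 X E F) in
/-- The isometry `T ↦ T_bil` of `LipL₀^int(X × E; F)` onto `BI(𝓕(X) × E; F)`. -/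
noncomputable def TbilEquiv : LipLInt 𝕜 X E F ≃ₗᵢ[𝕜] BilInt 𝕜 (LipFree 𝕜 X) E F where
  toFun T := ⟨Tbil T.toLipLZero, (isLipLIntegral_iff_Tbil _).1 T.2⟩
  -- `linearize` is defined by choice, so linearity in `T` is derived from uniqueness: both sides
  -- agree at every `δ_x`.
  map_add' S T := Subtype.ext <| Eq.symm <| Tbil_unique _
    (Tbil S.toLipLZero + Tbil T.toLipLZero) fun x e =>
      congrArg₂ (· + ·) (Tbil_delta S.toLipLZero x e) (Tbil_delta T.toLipLZero x e)
  map_smul' c T := Subtype.ext <| Eq.symm <| Tbil_unique _ (c • Tbil T.toLipLZero) fun x e =>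
    congrArg (c • ·) (Tbil_delta T.toLipLZero x e)
  invFun B := ⟨ofBil B.toBilinear, (isLipLIntegral_iff_Tbil _).2 (by rw [Tbil_ofBil]; exact B.2)⟩
  left_inv T := Subtype.ext <| Subtype.ext <| funext fun p => Tbil_delta T.toLipLZero p.1 p.2
  right_inv B := Subtype.ext (Tbil_ofBil B.toBilinear)
  norm_map' T := (lipLIntNorm_eq_Tbil T.toLipLZero).symm

end Correspondence

/-! ## The dual of the Lipschitz injective tensor product -/

section Dual

theorem box_add (x y : X) (e e' : E) : box 𝕜 x y (e + e') = box 𝕜 x y e + box 𝕜 x y e' :=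
  Subtype.ext (LinearMap.ext fun g => map_add (g x - g y) e e')

theorem box_smul (x y : X) (c : 𝕜) (e : E) : box 𝕜 x y (c • e) = c • box 𝕜 x y e :=
  Subtype.ext (LinearMap.ext fun g => map_smul (g x - g y) c e)

/-- Every generator is a difference of generators based at `0`, so a functional on `X ⊠ E` is
determined by its values on `box 𝕜 x 0 e`. -/
theorem box_zero_sub (x y : X) (e : E) : box 𝕜 x 0 e - box 𝕜 y 0 e = box 𝕜 x y e :=
  Subtype.ext <| LinearMap.ext fun g => by
    change (g x - g 0) e - (g y - g 0) e = (g x - g y) e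
    simp only [sub_apply]
    ring

theorem box_self (x : X) (e : E) : box 𝕜 x x e = 0 :=
  Subtype.ext <| LinearMap.ext fun g => by
    change (g x - g x) e = 0
    rw [sub_self, zero_apply]

theorem norm_box_le (x y : X) (e : E) : ‖box 𝕜 x y e‖ ≤ dist x y * ‖e‖ := by
  refine Real.iSup_le (fun p => ?_) (by positivity)
  rw [toDual_box_elem, norm_mul]
  have h1 := LipZero.norm_apply_sub_le_dist p.1.2 x y
  have h2 := norm_apply_le_of_norm_le_one p.2.2.le e
  gcongr

/-- For scalar-valued operators the weak supremum is the Lipschitz injective norm. -/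
theorem lipWeakSup_eq_norm {n : ℕ} (x y : Fin n → X) (e : Fin n → E)
    (z : Fin n → StrongDual 𝕜 𝕜) :
    lipWeakSup x y e z = ‖∑ i, box 𝕜 (x i) (y i) (z i 1 • e i)‖ := by
  rw [LipTensor.norm_sum_box, lipWeakSup]
  congr 1
  ext p
  -- A functional on `𝕜` is multiplication by its value at `1`, with the same norm; linearity of
  -- `e*` moves `z i 1` next to `e i`.
  have h : ∑ i, ((p.1.1 (x i) - p.1.1 (y i)) * p.2.1 (e i)) • z i =
      ContinuousLinearMap.toSpanSingleton 𝕜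
        (∑ i, (p.1.1 (x i) - p.1.1 (y i)) * p.2.1 (z i 1 • e i)) := by
    ext
    simp only [sum_apply, smul_apply, smul_eq_mul,
      ContinuousLinearMap.toSpanSingleton_apply, one_mul, map_smul]
    exact Finset.sum_congr rfl fun i _ => by ring
  rw [h, ContinuousLinearMap.norm_toSpanSingleton]

/-- The Lip-Linear operator `(x, e) ↦ φ(δ_{(x,0)} ⊠ e)`. -/
noncomputable def ofDual (φ : StrongDual 𝕜 (LipTensor 𝕜 X E)) : LipLZero 𝕜 X E 𝕜 :=
  ⟨fun p => φ (box 𝕜 p.1 0 p.2), ⟨⟨‖φ‖ + 1, by positivity, fun x y e => by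
      change ‖φ (box 𝕜 x 0 e) - φ (box 𝕜 y 0 e)‖ ≤ _
      rw [← map_sub, box_zero_sub, mul_assoc]
      exact φ.le_of_opNorm_le_of_le (by linarith) (norm_box_le x y e)⟩,
    fun x => ⟨fun e e' => (congrArg φ (box_add x 0 e e')).trans (map_add φ _ _),
      fun c e => (congrArg φ (box_smul x 0 c e)).trans (map_smul φ _ _)⟩⟩,
    fun e => by
      change φ (box 𝕜 0 0 e) = 0
      rw [box_self, map_zero]⟩

/-- The tensor on the right is the one in `lipWeakSup_eq_norm`, so the integrality inequality reads
`‖φ u‖ ≤ C * ‖u‖`. -/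
theorem sum_ofDual (φ : StrongDual 𝕜 (LipTensor 𝕜 X E)) {n : ℕ} (x y : Fin n → X)
    (e : Fin n → E) (z : Fin n → StrongDual 𝕜 𝕜) :
    ∑ i, z i ((ofDual φ).1 (x i, e i) - (ofDual φ).1 (y i, e i)) =
      φ (∑ i, box 𝕜 (x i) (y i) (z i 1 • e i)) := by
  rw [map_sum]
  refine Finset.sum_congr rfl fun i _ => ?_
  change z i (φ (box 𝕜 (x i) 0 (e i)) - φ (box 𝕜 (y i) 0 (e i))) = _
  rw [← map_sub, box_zero_sub, box_smul, map_smul, smul_eq_mul]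
  conv_lhs => rw [← mul_one (φ (box 𝕜 (x i) (y i) (e i))), ← smul_eq_mul, map_smul]
  rw [smul_eq_mul, mul_comm]

theorem lipLIntBound_ofDual_iff (φ : StrongDual 𝕜 (LipTensor 𝕜 X E)) {C : ℝ} (hC : 0 ≤ C) :
    LipLIntBound 𝕜 (ofDual φ).1 C ↔ ‖φ‖ ≤ C := by
  refine ⟨fun h => φ.opNorm_le_bound hC fun u => ?_, fun h n x y e z => ?_⟩
  · obtain ⟨n, x, y, e, rfl⟩ := u.exists_rep
    -- The identity has value `1` at `1`, so the given representation of the tensor is recovered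
    -- unchanged.
    have h1 := h n x y e fun _ => ContinuousLinearMap.id 𝕜 𝕜
    rw [sum_ofDual, lipWeakSup_eq_norm] at h1
    simpa only [ContinuousLinearMap.id_apply, one_smul] using h1
  · rw [sum_ofDual, lipWeakSup_eq_norm]
    exact φ.le_of_opNorm_le h _

theorem lipLIntNorm_ofDual (φ : StrongDual 𝕜 (LipTensor 𝕜 X E)) :
    lipLIntNorm 𝕜 (ofDual φ).1 = ‖φ‖ :=
  sInf_eq_of_bound_iff (norm_nonneg φ) fun _ hC => lipLIntBound_ofDual_iff φ hC

theorem isLipLIntegral_ofDual (φ : StrongDual 𝕜 (LipTensor 𝕜 X E)) :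
    IsLipLIntegral 𝕜 (ofDual φ).1 :=
  ⟨‖φ‖ + 1, by positivity, (lipLIntBound_ofDual_iff φ (by positivity)).2 (by linarith)⟩

/-- Elements of `X ⊠ E` are functionals on `Lip₀(X; E*)`, and `T` is itself a point of that space.
Evaluation at `curryLip T` is therefore automatically independent of the representation of a tensor.
-/
theorem toDual_box_curryLip (T : LipLZero 𝕜 X E 𝕜) (x y : X) (e : E) :
    (box 𝕜 x y e).toDual (curryLip T) = T.1 (x, e) - T.1 (y, e) := rfl

/-- The functional on `X ⊠ E` given by an integral scalar-valued operator. -/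
noncomputable def toDualFunctional (T : LipLInt 𝕜 X E 𝕜) : StrongDual 𝕜 (LipTensor 𝕜 X E) :=
  LinearMap.mkContinuousOfExistsBound (LipTensor.toDual.flip (curryLip T.toLipLZero)) <| by
    obtain ⟨C, -, hC⟩ := T.2
    refine ⟨C, fun u => ?_⟩
    obtain ⟨n, x, y, e, rfl⟩ := u.exists_rep
    have h1 := hC n x y e fun _ => ContinuousLinearMap.id 𝕜 𝕜
    rw [lipWeakSup_eq_norm] at h1
    simp only [ContinuousLinearMap.id_apply, one_smul] at h1
    rw [map_sum]
    exact h1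

theorem ofDual_toDualFunctional (T : LipLInt 𝕜 X E 𝕜) :
    ofDual (toDualFunctional T) = T.toLipLZero :=
  Subtype.ext <| funext fun p => by
    change (box 𝕜 p.1 0 p.2).toDual (curryLip T.toLipLZero) = _
    rw [toDual_box_curryLip, T.toLipLZero.2.2, sub_zero]

theorem ofDual_injective :
    Function.Injective (ofDual : StrongDual 𝕜 (LipTensor 𝕜 X E) → LipLZero 𝕜 X E 𝕜) := by
  intro φ ψ h
  ext u
  obtain ⟨n, x, y, e, rfl⟩ := u.exists_rep
  have h1 := sum_ofDual φ x y e fun _ => ContinuousLinearMap.id 𝕜 𝕜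
  rw [h, sum_ofDual] at h1
  simpa only [ContinuousLinearMap.id_apply, one_smul] using h1.symm

variable (𝕜 X E) in
/-- The isometry of `(X ⊠ E)*` onto `LipL₀^int(X × E; 𝕜)`. -/
noncomputable def dualEquiv : StrongDual 𝕜 (LipTensor 𝕜 X E) ≃ₗᵢ[𝕜] LipLInt 𝕜 X E 𝕜 where
  toFun φ := ⟨ofDual φ, isLipLIntegral_ofDual φ⟩
  map_add' _ _ := rfl
  map_smul' _ _ := rfl
  invFun := toDualFunctional
  -- An injective map with a right inverse is inverted by it.
  left_inv φ := ofDual_injective (ofDual_toDualFunctional ⟨ofDual φ, isLipLIntegral_ofDual φ⟩)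
  right_inv T := Subtype.ext (ofDual_toDualFunctional T)
  norm_map' φ := lipLIntNorm_ofDual φ

end Dual

end

/-! ## The dual of a completion -/

section Completion

variable (𝕜 V : Type*) [RCLike 𝕜] [NormedAddCommGroup V] [NormedSpace 𝕜 V]

/-- Restriction is an isometry of the dual of the completion of `V` onto the dual of `V`. -/
noncomputable def dualCompletionEquiv :
    StrongDual 𝕜 (UniformSpace.Completion V) ≃ₗᵢ[𝕜] StrongDual 𝕜 V where
  toFun φ := φ.comp UniformSpace.Completion.toComplL
  map_add' _ _ := rfl
  map_smul' _ _ := rfl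
  invFun ψ := ψ.extend UniformSpace.Completion.toComplL
  left_inv φ := by
    ext u
    refine UniformSpace.Completion.ext' (ContinuousLinearMap.continuous _) φ.continuous
      (fun a => ?_) u
    exact ContinuousLinearMap.extend_eq _ UniformSpace.Completion.denseRange_coe
      (UniformSpace.Completion.isUniformInducing_coe V) a
  right_inv ψ := by
    ext a
    exact ContinuousLinearMap.extend_eq _ UniformSpace.Completion.denseRange_coe
      (UniformSpace.Completion.isUniformInducing_coe V) a
  norm_map' φ := by
    refine le_antisymm (ContinuousLinearMap.opNorm_le_bound _ (norm_nonneg _) fun a => ?_)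
      (ContinuousLinearMap.opNorm_le_bound _ (norm_nonneg _) fun u => ?_)
    · exact (φ.le_opNorm a).trans_eq (by rw [UniformSpace.Completion.norm_coe])
    -- The inequality is a closed condition on `u`, so it need only be checked on the dense copy of
    -- `V`.
    · refine UniformSpace.Completion.induction_on u (isClosed_le (by fun_prop) (by fun_prop))
        fun a => ?_
      rw [UniformSpace.Completion.norm_coe]
      exact (φ.comp UniformSpace.Completion.toComplL).le_opNorm a

end Completion

end LipLin

open LipLin in
theorem mainTheorem4 (𝕜 X E F : Type*) [RCLike 𝕜] [MetricSpace X] [Zero X]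
    [NormedAddCommGroup E] [NormedSpace 𝕜 E] [CompleteSpace E]
    [NormedAddCommGroup F] [NormedSpace 𝕜 F] [CompleteSpace F] :
    (∀ T : LipLZero 𝕜 X E F,
      (IsLipLIntegral 𝕜 T.1 ↔ IsBilIntegral (Tbil T)) ∧
      (IsLipLIntegral 𝕜 T.1 → lipLIntNorm 𝕜 T.1 = bilIntNorm (Tbil T))) ∧
    (∃ Φ : LipLInt 𝕜 X E F ≃ₗᵢ[𝕜] BilInt 𝕜 (LipFree 𝕜 X) E F,
      ∀ T : LipLInt 𝕜 X E F, (Φ T).toBilinear = Tbil T.toLipLZero) ∧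
    (∃ Ψ : StrongDual 𝕜 (InjLipTensor 𝕜 X E) ≃ₗᵢ[𝕜] LipLInt 𝕜 X E 𝕜,
      ∀ (φ : StrongDual 𝕜 (InjLipTensor 𝕜 X E)) (x : X) (e : E),
        (Ψ φ).toLipLZero.1 (x, e) = φ (box 𝕜 x 0 e : LipTensor 𝕜 X E)) := by
  exact ⟨fun T => ⟨isLipLIntegral_iff_Tbil T, fun _ => lipLIntNorm_eq_Tbil T⟩,
    ⟨TbilEquiv 𝕜 X E F, fun _ => rfl⟩,
    ⟨(dualCompletionEquiv 𝕜 (LipTensor 𝕜 X E)).trans (dualEquiv 𝕜 X E), fun _ _ _ => rfl⟩⟩
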